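/- Let $\alpha,\beta,m_0,m_1,\gamma,x_0$ be real parameters with $\alpha m_1>0$, and consider the Chua memristor system $$\dot x=\alpha(m_0-1)x+\alpha y-\alpha m_1x^3+\alpha x_0,\qquad \dot y=x-y+z,\qquad \dot z=\beta y-\gamma z,$$ written as $\dot u=f(u)$ with $u=(x,y,z)\in\mathbb{R}^3$. Let $J(u)=Df(u)$ be the Jacobian matrix of $f$ and let $\lambda_1(u)\ge\lambda_2(u)\ge\lambda_3(u)$ be the eigenvalues, counted with multiplicity, of the symmetrized Jacobian $\tfrac12\big(J(u)+J(u)^{*}\big)$. If $$\lambda_1(0)+\lambda_2(0)<0,$$ then every solution $u:[0,+\infty)\to\mathbb{R}^3$ of the system that is bounded on $[0,+\infty)$ tends to the stationary set $\{p\in\mathbb{R}^3: f(p)=0\}$ as $t\to+\infty$, that is, the distance from $u(t)$ to this set tends to $0$. -/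

import Mathlib

/-- Phase space `ℝ³` with the Euclidean norm; coordinates `u 0 = x`, `u 1 = y`, `u 2 = z`. -/
abbrev Phase : Type := EuclideanSpace ℝ (Fin 3)

/-- Right-hand side of the Chua memristor system. -/
noncomputable def chuaField (α β m₀ m₁ γ x₀ : ℝ) (u : Phase) : Phase :=
  !₂[α * (m₀ - 1) * u 0 + α * u 1 - α * m₁ * u 0 ^ 3 + α * x₀,
     u 0 - u 1 + u 2,
     β * u 1 - γ * u 2]

/-- The Jacobian matrix `J(u) = Df(u)` of the right-hand side. -/
noncomputable def chuaJacobian (α β m₀ m₁ γ : ℝ) (u : Phase) : Matrix (Fin 3) (Fin 3) ℝ :=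
  !![α * (m₀ - 1) - 3 * α * m₁ * u 0 ^ 2, α, 0;
     1, -1, 1;
     0, β, -γ]

/-- `chuaJacobian` really is the matrix of the Fréchet derivative of `chuaField`. -/
theorem hasFDerivAt_chuaField (α β m₀ m₁ γ x₀ : ℝ) (u : Phase) :
    HasFDerivAt (chuaField α β m₀ m₁ γ x₀)
      (Matrix.toEuclideanCLM (𝕜 := ℝ) (chuaJacobian α β m₀ m₁ γ u)) u := by
  rw [← hasFDerivWithinAt_univ, hasFDerivWithinAt_euclidean]
  have h : ∀ i : Fin 3, HasFDerivAt (fun v : Phase => v i)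
      (EuclideanSpace.proj i : Phase →L[ℝ] ℝ) u := fun i =>
    (EuclideanSpace.proj i : Phase →L[ℝ] ℝ).hasFDerivAt
  intro i
  rw [hasFDerivWithinAt_univ]
  fin_cases i
  · refine (((((h 0).const_mul (α * (m₀ - 1))).add ((h 1).const_mul α)).sub
      (((h 0).pow 3).const_mul (α * m₁))).add_const (α * x₀)).congr_fderiv ?_
    ext v
    simp [chuaJacobian, Matrix.ofLp_toEuclideanCLM, Matrix.mulVec, dotProduct,
      Fin.sum_univ_three]
    ring
  · refine (((h 0).sub (h 1)).add (h 2)).congr_fderiv ?_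
    ext v
    simp [chuaJacobian, Matrix.ofLp_toEuclideanCLM, Matrix.mulVec, dotProduct,
      Fin.sum_univ_three]
    ring
  · refine (((h 1).const_mul β).sub ((h 2).const_mul γ)).congr_fderiv ?_
    ext v
    simp [chuaJacobian, Matrix.ofLp_toEuclideanCLM, Matrix.mulVec, dotProduct,
      Fin.sum_univ_three]
    ring

/-- The symmetrized Jacobian `(J(u) + J(u)ᵀ) / 2`. -/
noncomputable def chuaSymJacobian (α β m₀ m₁ γ : ℝ) (u : Phase) : Matrix (Fin 3) (Fin 3) ℝ :=
  (1 / 2 : ℝ) • (chuaJacobian α β m₀ m₁ γ u + (chuaJacobian α β m₀ m₁ γ u).transpose)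

theorem chuaSymJacobian_isHermitian (α β m₀ m₁ γ : ℝ) (u : Phase) :
    (chuaSymJacobian α β m₀ m₁ γ u).IsHermitian := by
  ext i j
  simp [chuaSymJacobian]
  ring

/-- The eigenvalues of the symmetrized Jacobian at `u`, counted with multiplicity, in decreasing
order: `chuaEigenvalue … u 0 ≥ chuaEigenvalue … u 1 ≥ chuaEigenvalue … u 2`. -/
noncomputable def chuaEigenvalue (α β m₀ m₁ γ : ℝ) (u : Phase) (j : Fin 3) : ℝ :=
  (chuaSymJacobian_isHermitian α β m₀ m₁ γ u).eigenvalues₀ (Fin.cast (Fintype.card_fin 3).symm j)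

theorem chuaEigenvalue_antitone (α β m₀ m₁ γ : ℝ) (u : Phase) :
    Antitone (chuaEigenvalue α β m₀ m₁ γ u) := fun _ _ h =>
  (chuaSymJacobian_isHermitian α β m₀ m₁ γ u).eigenvalues₀_antitone h

/-- `u` solves the Chua memristor system on `[0, +∞)` (one-sided derivative at `0`). -/
def IsChuaSolution (α β m₀ m₁ γ x₀ : ℝ) (u : ℝ → Phase) : Prop :=
  ∀ t : ℝ, 0 ≤ t → HasDerivWithinAt u (chuaField α β m₀ m₁ γ x₀ (u t)) (Set.Ici 0) t

/-- The stationary set: all equilibria of the system. -/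
def chuaStationarySet (α β m₀ m₁ γ x₀ : ℝ) : Set Phase :=
  {p | chuaField α β m₀ m₁ γ x₀ p = 0}

/-- `u(t)` tends to the set `S` as `t → +∞`: the distance from `u(t)` to `S` tends to zero
(this fails when `S` is empty). -/
def TendsToSet (u : ℝ → Phase) (S : Set Phase) : Prop :=
  ∀ ε : ℝ, 0 < ε → ∃ T : ℝ, ∀ t : ℝ, T ≤ t → ∃ p ∈ S, dist (u t) p < ε

/-!
Every bounded solution converges to the stationary set because, under the spectral hypothesis, the
Chua system has a strict Lyapunov function `V` with `V̇ ≤ -ε ‖f‖²`.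

Write `a = α (m₀ - 1)`, so that the Jacobian is `J(u) = A - 3 α m₁ x² e₁ e₁ᵀ` with `A` constant.
The function is `V = τ / 2 * f₁² + G` with `τ ≥ 0`, where `∇ G = P f` for a constant matrix
`P = !![κ, p, r; 0, b, c; 0, d, e]`. Such a `G` exists exactly when `P J(u)` is symmetric for all
`u`; this fixes `b = κ α - p + r β` and `d = p - r γ` and leaves the single relation
`c γ + e β = κ α + r (β - γ)`. Along a solution
`V̇ = τ f₁ (a f₁ + α f₂) + fᵀ P f - 3 τ α m₁ x² f₁²`, and since `α m₁ > 0` it is enough that the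
constant quadratic form made of the first two terms be negative definite
(`hasDerivWithinAt_chuaLyapunov`).

For the spectral hypothesis, `λ₁(0) + λ₂(0) < 0` says that `S - (tr S) I` is positive definite,
`S` being the symmetrized Jacobian at the origin, since its least eigenvalue is
`λ₃ - tr S = -(λ₁ + λ₂)`. Positivity of its principal minors yields the inequalities of
`parameter_bounds_of_eigenvalue_sum_neg`, and these suffice to choose `τ, κ, p, r, c, e`
explicitly, according to the signs of `α` and `β` (`exists_multiplier`).

As `V` is bounded below along a bounded solution, and `‖f‖²` is Lipschitz along it, a Barbalat
argument (`tendsto_zero_of_hasDerivWithinAt_le_neg`) gives `f (u t) → 0`. Compactness turns this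
into convergence to the zero set of `f` (`tendsToSet_of_tendsto_zero`).
-/

section

open Filter Topology Set

/-! ### The quadratic form in the velocities -/

/-- A positive definite binary quadratic form is bounded below by a positive multiple of the
standard one; the constant is the determinant divided by the trace. -/
theorem exists_le_quadratic_form_two {a b c : ℝ} (ha : 0 < a) (h : b ^ 2 < a * c) :
    ∃ μ : ℝ, 0 < μ ∧ ∀ X Y : ℝ, μ * (X ^ 2 + Y ^ 2) ≤ a * X ^ 2 + 2 * b * X * Y + c * Y ^ 2 := by
  have hc : 0 < c := by nlinarith [sq_nonneg b]
  refine ⟨(a * c - b ^ 2) / (a + c), div_pos (by linarith) (by linarith), fun X Y => ?_⟩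
  rw [div_mul_eq_mul_div, div_le_iff₀ (by linarith)]
  -- the difference of the two sides is a sum of two squares
  nlinarith [sq_nonneg (a * X + b * Y), sq_nonneg (b * X + c * Y)]

/-- The algebraic core: the parameter inequalities allow a choice of `τ`, `κ`, `p`, `r`, `c`, `e`
that meets the compatibility relation and makes the quadratic form in the velocities
`(X, Y, Z) = (x', y', z')` negative definite. Here `a` stands for `α (m₀ - 1)`. -/
theorem exists_multiplier {a α β γ : ℝ} (hα : α ≠ 0) (h1 : 0 < 1 + γ) (h2 : 0 < γ - a)
    (h3 : 0 < 1 - a) (h12 : α < (1 + γ) * (γ - a)) (h23 : β < (γ - a) * (1 - a)) :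
    ∃ τ κ p r c e ε : ℝ, 0 ≤ τ ∧ 0 < ε ∧ c * γ + e * β = κ * α + r * (β - γ) ∧
      ∀ X Y Z : ℝ,
        τ * X * (a * X + α * Y) + κ * X ^ 2 + p * X * Y + r * X * Z
          + (κ * α - p + r * β) * Y ^ 2 + (c + p - r * γ) * Y * Z + e * Z ^ 2
          ≤ -(ε * (X ^ 2 + Y ^ 2 + Z ^ 2)) := by
  rcases lt_or_gt_of_ne hα with hα | hα
  · rcases lt_trichotomy β 0 with hβ | hβ | hβ
    · -- `α < 0`, `β < 0`: at `δ = 0` the form is diagonal but has no `Y²` term; a small `δ`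
      -- supplies it, the bounds on `δ` keeping the `(X, Y)` block and the `Z²` term definite
      obtain ⟨δ, hδ, hδ1, hδ2⟩ : ∃ δ : ℝ, 0 < δ ∧ δ ≤ 1 - a ∧ δ ≤ -α * (1 + γ) :=
        ⟨min (1 - a) (-α * (1 + γ)), lt_min h3 (by nlinarith), min_le_left _ _, min_le_right _ _⟩
      obtain ⟨μ, hμ, H⟩ := exists_le_quadratic_form_two (a := 1 - a) (b := -δ / 2) (c := δ) h3
        (by nlinarith)
      have hE : 0 < (α * (1 + γ) - δ * γ) / β := div_pos_of_neg_of_neg (by nlinarith) hβ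
      refine ⟨1, -1, δ - α, 0, α - δ, -((α * (1 + γ) - δ * γ) / β),
        min μ ((α * (1 + γ) - δ * γ) / β), zero_le_one, lt_min hμ hE, ?_, fun X Y Z => ?_⟩
      · field_simp [hβ.ne]
        ring
      · have := H X Y
        have h4 := mul_le_mul_of_nonneg_right (min_le_left μ ((α * (1 + γ) - δ * γ) / β))
          (by positivity : 0 ≤ X ^ 2 + Y ^ 2)
        have h5 := mul_le_mul_of_nonneg_right (min_le_right μ ((α * (1 + γ) - δ * γ) / β))
          (sq_nonneg Z)
        linarith
    · -- `α < 0`, `β = 0`: the relation no longer involves `e`, so `e` is taken very negative and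
      -- only the `(X, Y)` block has to be definite
      subst hβ
      obtain ⟨κ, p, c, μ, hμ, hc, H⟩ : ∃ κ p c μ : ℝ, 0 < μ ∧ c * γ = κ * α ∧ ∀ X Y : ℝ,
          μ * (X ^ 2 + Y ^ 2)
            ≤ -(a + κ) * X ^ 2 + 2 * (-(p + α) / 2) * X * Y + (p - κ * α) * Y ^ 2 := by
        rcases eq_or_ne γ 0 with hγ | hγ
        · subst hγ
          obtain ⟨μ, hμ, H⟩ := exists_le_quadratic_form_two
            (a := -(a + 0)) (b := -(-α + α) / 2) (c := -α - 0 * α) (by linarith) (by nlinarith)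
          exact ⟨0, -α, 0, μ, hμ, by simp, H⟩
        · obtain ⟨μ, hμ, H⟩ := exists_le_quadratic_form_two
            (a := -(a + -1)) (b := -(1 - a - α + α) / 2) (c := 1 - a - α - -1 * α) (by linarith)
            (by nlinarith)
          exact ⟨-1, 1 - a - α, -α / γ, μ, hμ, by field_simp, H⟩
      refine ⟨1, κ, p, 0, c, -((c + p) ^ 2 / (2 * μ) + 1), min (μ / 2) 1, zero_le_one,
        lt_min (by linarith) one_pos, by linarith, fun X Y Z => ?_⟩
      have := H X Y
      have h4 := mul_le_mul_of_nonneg_right (min_le_left (μ / 2) 1)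
        (by positivity : 0 ≤ X ^ 2 + Y ^ 2)
      have h5 := mul_le_mul_of_nonneg_right (min_le_right (μ / 2) 1) (sq_nonneg Z)
      have h6 : (c + p) * Y * Z ≤ μ / 2 * Y ^ 2 + (c + p) ^ 2 / (2 * μ) * Z ^ 2 := by
        have : μ / 2 * Y ^ 2 + (c + p) ^ 2 / (2 * μ) * Z ^ 2 - (c + p) * Y * Z
            = (μ * Y - (c + p) * Z) ^ 2 / (2 * μ) := by
          field_simp
          ring
        have h7 : 0 ≤ (μ * Y - (c + p) * Z) ^ 2 / (2 * μ) := by positivity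
        linarith
      have h8 : 0 ≤ μ / 2 * X ^ 2 := by positivity
      linarith
    · -- `α < 0`, `β > 0`: for `δ = 0` the `(Y, Z)` block is definite by `h23` but the `X²` term
      -- vanishes; a small `δ` adds it without destroying the block
      obtain ⟨δ, hδ, hδ1, hδ2⟩ : ∃ δ : ℝ, 0 < δ ∧ δ < 1 - a ∧
          β < (1 - a - δ) * (γ - a - δ) := by
        have hs : 0 < (1 - a) + (γ - a) := by linarith
        refine ⟨((γ - a) * (1 - a) - β) / ((1 - a) + (γ - a)), div_pos (by linarith) hs, ?_, ?_⟩
        · rw [div_lt_iff₀ hs]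
          nlinarith
        · have h4 : ((γ - a) * (1 - a) - β) / ((1 - a) + (γ - a)) * ((1 - a) + (γ - a))
            = (γ - a) * (1 - a) - β := div_mul_cancel₀ _ hs.ne'
          have h5 : 0 < ((γ - a) * (1 - a) - β) / ((1 - a) + (γ - a)) :=
            div_pos (by linarith) hs
          nlinarith
      obtain ⟨μ, hμ, H⟩ := exists_le_quadratic_form_two (a := 1 - a - δ) (b := -1)
        (c := (γ - a - δ) / β) (by linarith)
        (by rw [← mul_div_assoc, lt_div_iff₀ hβ]; linarith)
      refine ⟨1, -(a + δ), -α, 0, -α, α * ((γ - a - δ) / β), min δ (-α * μ), zero_le_one,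
        lt_min hδ (by nlinarith), ?_, fun X Y Z => ?_⟩
      · field_simp
        ring
      · have := mul_le_mul_of_nonneg_left (H Y Z) (by linarith : 0 ≤ -α)
        have h4 := mul_le_mul_of_nonneg_right (min_le_left δ (-α * μ)) (sq_nonneg X)
        have h5 := mul_le_mul_of_nonneg_right (min_le_right δ (-α * μ))
          (by positivity : 0 ≤ Y ^ 2 + Z ^ 2)
        linarith
  · rcases le_or_gt β 0 with hβ | hβ
    · -- `α > 0`, `β ≤ 0`: for `ρ = 0` the form is definite in `(X, Y)` by `h12` and free of `Z`;
      -- a small `ρ` adds the `Z²` term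
      obtain ⟨μ, hμ, H⟩ := exists_le_quadratic_form_two (a := γ - a) (b := -α)
        (c := α * (1 + γ)) h2 (by nlinarith)
      have hK : 0 < 2 * (1 + (1 + γ) ^ 2 - β) := by nlinarith [sq_nonneg (1 + γ)]
      obtain ⟨ρ, hρ, hρμ⟩ : ∃ ρ : ℝ, 0 < ρ ∧ ρ * (2 * (1 + (1 + γ) ^ 2 - β)) = μ :=
        ⟨μ / (2 * (1 + (1 + γ) ^ 2 - β)), div_pos hμ hK, div_mul_cancel₀ _ hK.ne'⟩
      refine ⟨1, -γ, α, -ρ, ρ - α, -ρ, min (μ / 2) (ρ / 2), zero_le_one,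
        lt_min (by linarith) (by linarith), by ring, fun X Y Z => ?_⟩
      have := H X Y
      have h4 := mul_le_mul_of_nonneg_right (min_le_left (μ / 2) (ρ / 2))
        (by positivity : 0 ≤ X ^ 2 + Y ^ 2)
      have h5 := mul_le_mul_of_nonneg_right (min_le_right (μ / 2) (ρ / 2)) (sq_nonneg Z)
      have h6 := mul_nonneg hρ.le (sq_nonneg (X + Z / 2))
      have h7 := mul_nonneg hρ.le (sq_nonneg ((1 + γ) * Y - Z / 2))
      have h8 : 0 ≤ ρ * ((1 + γ) ^ 2 - β) * X ^ 2 :=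
        mul_nonneg (mul_nonneg hρ.le (by nlinarith [sq_nonneg (1 + γ)])) (sq_nonneg X)
      have h9 := mul_nonneg hρ.le (sq_nonneg Y)
      have h10 : ρ * (2 * (1 + (1 + γ) ^ 2 - β)) * (X ^ 2 + Y ^ 2) = μ * (X ^ 2 + Y ^ 2) := by
        rw [hρμ]
      linarith
    · -- `α > 0`, `β > 0`: the system is a gradient system for a diagonal metric, and its
      -- potential alone is a Lyapunov function
      refine ⟨0, -1, 0, 0, 0, -(α / β), min 1 (min α (α / β)), le_rfl,
        lt_min one_pos (lt_min hα (div_pos hα hβ)), ?_, fun X Y Z => ?_⟩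
      · field_simp
        ring
      · have h4 := mul_le_mul_of_nonneg_right (min_le_left 1 (min α (α / β))) (sq_nonneg X)
        have h5 := mul_le_mul_of_nonneg_right
          ((min_le_right 1 (min α (α / β))).trans (min_le_left _ _)) (sq_nonneg Y)
        have h6 := mul_le_mul_of_nonneg_right
          ((min_le_right 1 (min α (α / β))).trans (min_le_right _ _)) (sq_nonneg Z)
        linarith

/-! ### Consequences of the spectral hypothesis -/

/-- If `λ₁(0) + λ₂(0) < 0` then `S - (tr S) I` is positive definite, where `S` is the symmetrized
Jacobian at the origin. -/
theorem chuaSymJacobian_quadratic_form_pos {α β m₀ m₁ γ : ℝ}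
    (hlam : chuaEigenvalue α β m₀ m₁ γ 0 0 + chuaEigenvalue α β m₀ m₁ γ 0 1 < 0)
    {v : Fin 3 → ℝ} (hv : v ≠ 0) :
    0 < v ⬝ᵥ (chuaSymJacobian α β m₀ m₁ γ 0).mulVec v
      - (chuaSymJacobian α β m₀ m₁ γ 0).trace * (v ⬝ᵥ v) := by
  set S := chuaSymJacobian α β m₀ m₁ γ 0
  have hS : S.IsHermitian := chuaSymJacobian_isHermitian α β m₀ m₁ γ 0
  set l : Fin 3 → ℝ := chuaEigenvalue α β m₀ m₁ γ 0
  have htr : S.trace = l 0 + l 1 + l 2 := by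
    rw [hS.trace_eq_sum_eigenvalues, ← Fin.sum_univ_three l]
    simp only [Matrix.IsHermitian.eigenvalues, RCLike.ofReal_real_eq_id, id]
    rw [Equiv.sum_comp (Fintype.equivOfCardEq (Fintype.card_fin _)).symm hS.eigenvalues₀]
    exact (Equiv.sum_comp (finCongr (Fintype.card_fin 3).symm) hS.eigenvalues₀).symm
  have hmin : ∀ i, l 2 ≤ hS.eigenvalues i := by
    intro i
    refine hS.eigenvalues₀_antitone ?_
    rw [Fin.le_def]
    have := ((Fintype.equivOfCardEq (Fintype.card_fin (Fintype.card (Fin 3)))).symm i).isLt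
    simp only [Fintype.card_fin] at this
    simpa using Nat.le_of_lt_succ this
  have hray : l 2 * (v ⬝ᵥ v) ≤ v ⬝ᵥ S.mulVec v := by
    have hps : (S - l 2 • (1 : Matrix (Fin 3) (Fin 3) ℝ)).PosSemidef := by
      have hH : (S - l 2 • (1 : Matrix (Fin 3) (Fin 3) ℝ)).IsHermitian :=
        hS.sub (by simp [Matrix.IsHermitian])
      rw [hH.posSemidef_iff_eigenvalues_nonneg]
      intro i
      have hi := hH.eigenvalues_mem_spectrum_real i
      have hi' : hH.eigenvalues i + l 2 ∈ spectrum ℝ S := by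
        rw [spectrum.add_mem_iff, neg_add_eq_sub, Algebra.algebraMap_eq_smul_one]
        exact hi
      rw [hS.spectrum_real_eq_range_eigenvalues] at hi'
      obtain ⟨j, hj⟩ := hi'
      have := hmin j
      simp only [Pi.zero_apply]
      linarith
    have := hps.dotProduct_mulVec_nonneg v
    simp [Matrix.sub_mulVec, Matrix.smul_mulVec, dotProduct_sub] at this
    linarith
  have hvv : 0 < v ⬝ᵥ v := by
    refine lt_of_le_of_ne (Finset.sum_nonneg fun i _ => mul_self_nonneg _) (Ne.symm ?_)
    simpa using hv
  rw [htr]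
  nlinarith

theorem parameter_bounds_of_eigenvalue_sum_neg {α β m₀ m₁ γ : ℝ}
    (hlam : chuaEigenvalue α β m₀ m₁ γ 0 0 + chuaEigenvalue α β m₀ m₁ γ 0 1 < 0) :
    0 < 1 + γ ∧ 0 < γ - α * (m₀ - 1) ∧ 0 < 1 - α * (m₀ - 1) ∧
      α < (1 + γ) * (γ - α * (m₀ - 1)) ∧ β < (γ - α * (m₀ - 1)) * (1 - α * (m₀ - 1)) := by
  -- the quadratic form of `S - (tr S) I`, written out
  have key : ∀ x y z : ℝ, ![x, y, z] ≠ 0 →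
      0 < (1 + γ) * x ^ 2 + (γ - α * (m₀ - 1)) * y ^ 2 + (1 - α * (m₀ - 1)) * z ^ 2
        + (1 + α) * x * y + (1 + β) * y * z := by
    intro x y z h
    have := chuaSymJacobian_quadratic_form_pos hlam h
    simp [chuaSymJacobian, chuaJacobian, Matrix.mulVec, dotProduct, Fin.sum_univ_three,
      Matrix.trace] at this
    linarith
  have h1 : 0 < 1 + γ := by simpa using key 1 0 0 (by simp)
  have h2 : 0 < γ - α * (m₀ - 1) := by simpa using key 0 1 0 (by simp)
  have h3 : 0 < 1 - α * (m₀ - 1) := by simpa using key 0 0 1 (by simp)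
  -- vectors at which the form factors through its two principal minors of order two
  have h12 := key (1 + α) (-2 * (1 + γ)) 0 (by simp [h1.ne'])
  have h23 := key 0 (-2 * (1 - α * (m₀ - 1))) (1 + β) (by simp [h3.ne'])
  refine ⟨h1, h2, h3, ?_, ?_⟩
  -- the minors bound `(1 + α)² / 4` and `(1 + β)² / 4`, which dominate `α` and `β`
  · have : 0 < (1 + γ) * (4 * ((1 + γ) * (γ - α * (m₀ - 1))) - (1 + α) ^ 2) := by linarith
    have := pos_of_mul_pos_right this h1.le
    nlinarith [sq_nonneg (1 - α)]
  · have : 0 < (1 - α * (m₀ - 1)) *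
        (4 * ((γ - α * (m₀ - 1)) * (1 - α * (m₀ - 1))) - (1 + β) ^ 2) := by linarith
    have := pos_of_mul_pos_right this h3.le
    nlinarith [sq_nonneg (1 - β)]

/-! ### Convergence from a strict Lyapunov function -/

/-- A Barbalat lemma: if `V` is bounded below and decreases at rate at least `g ≥ 0`, and `g` is
Lipschitz, then `g` tends to zero. -/
theorem tendsto_zero_of_hasDerivWithinAt_le_neg {V V' g : ℝ → ℝ} {m K : ℝ}
    (hV : ∀ t, 0 ≤ t → HasDerivWithinAt V (V' t) (Ici 0) t)
    (hV' : ∀ t, 0 ≤ t → V' t ≤ -g t) (hm : ∀ t, 0 ≤ t → m ≤ V t)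
    (hg : ∀ t, 0 ≤ t → 0 ≤ g t) (hK : 0 ≤ K)
    (hgK : ∀ s t, 0 ≤ s → 0 ≤ t → |g s - g t| ≤ K * |s - t|) :
    Tendsto g atTop (𝓝 0) := by
  have hder : ∀ x ∈ interior (Ici (0 : ℝ)), HasDerivAt V (V' x) x := by
    intro x hx
    rw [interior_Ici] at hx
    exact (hV x (le_of_lt hx)).hasDerivAt (Ici_mem_nhds hx)
  have hcont : ContinuousOn V (Ici 0) := fun t ht => (hV t ht).continuousWithinAt
  have hanti : AntitoneOn V (Ici 0) :=
    antitoneOn_of_hasDerivWithinAt_nonpos (convex_Ici 0) hcont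
      (fun x hx => (hder x hx).hasDerivWithinAt) fun x hx => by
        have hx0 : 0 ≤ x := interior_subset hx
        linarith [hV' x hx0, hg x hx0]
  have hbdd : BddBelow (V '' Ici 0) := ⟨m, by rintro _ ⟨t, ht, rfl⟩; exact hm t ht⟩
  rw [Metric.tendsto_atTop]
  intro η hη
  -- `g` cannot fall from `η` below `η / 2` within time `h`
  obtain ⟨h, hh, hhK⟩ : ∃ h : ℝ, 0 < h ∧ K * h ≤ η / 2 := by
    refine ⟨η / (2 * (K + 1)), by positivity, ?_⟩
    rw [← mul_div_assoc, div_le_div_iff₀ (by linarith) two_pos]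
    nlinarith
  -- from time `T` on, `V` has less than `η / 2 * h` left to lose
  obtain ⟨_, ⟨T, hT, rfl⟩, hTlt⟩ := exists_lt_of_csInf_lt (⟨V 0, 0, self_mem_Ici, rfl⟩ :
    (V '' Ici 0).Nonempty) (lt_add_of_pos_right (sInf (V '' Ici 0)) (by positivity : 0 < η / 2 * h))
  refine ⟨T, fun t ht => ?_⟩
  have hT0 : (0 : ℝ) ≤ T := hT
  have ht0 : 0 ≤ t := hT0.trans ht
  rw [Real.dist_0_eq_abs, abs_of_nonneg (hg t ht0)]
  by_contra! hge
  have hdrop : V (t + h) - V t ≤ -(η / 2) * (t + h - t) := by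
    refine (convex_Icc t (t + h)).image_sub_le_mul_sub_of_deriv_le
      (hcont.mono fun x hx => ht0.trans hx.1) ?_ ?_ t (by simp [hh.le]) (t + h) (by simp [hh.le])
      (by linarith)
    · intro x hx
      rw [interior_Icc] at hx
      exact (hder x (by rw [interior_Ici]; exact ht0.trans_lt hx.1)).differentiableAt
        |>.differentiableWithinAt
    · intro x hx
      rw [interior_Icc] at hx
      have hx0 : 0 < x := ht0.trans_lt hx.1
      rw [(hder x (by rwa [interior_Ici])).deriv]
      have h1 := hV' x hx0.le
      have h2 := (abs_le.1 (hgK x t hx0.le ht0)).1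
      have h3 : K * |x - t| ≤ K * h :=
        mul_le_mul_of_nonneg_left (by rw [abs_of_nonneg] <;> linarith [hx.1, hx.2]) hK
      linarith
  have h1 : sInf (V '' Ici 0) ≤ V (t + h) :=
    csInf_le hbdd ⟨t + h, add_nonneg ht0 hh.le, rfl⟩
  have h2 : V t ≤ V T := hanti hT ht0 ht
  linarith

/-- A trajectory in a ball along which the continuous field `f` tends to zero tends to the zero set
of `f`: off any neighbourhood of that set, `‖f‖` is bounded away from zero on the ball. -/
theorem tendsToSet_of_tendsto_zero {f : Phase → Phase} (hf : Continuous f) {u : ℝ → Phase} {R : ℝ}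
    (hR : ∀ t, 0 ≤ t → ‖u t‖ ≤ R) (h : Tendsto (fun t => ‖f (u t)‖) atTop (𝓝 0)) :
    TendsToSet u {p | f p = 0} := by
  intro ε hε
  have hK : IsCompact (Metric.closedBall (0 : Phase) R \ Metric.thickening ε {p | f p = 0}) :=
    (isCompact_closedBall 0 R).diff Metric.isOpen_thickening
  have hpos : ∀ q ∈ Metric.closedBall (0 : Phase) R \ Metric.thickening ε {p | f p = 0},
      0 < ‖f q‖ := by
    intro q hq
    rw [norm_pos_iff]
    exact fun h0 => hq.2 (Metric.self_subset_thickening hε _ h0)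
  obtain ⟨δ, hδ, hδK⟩ := hK.exists_forall_le' hf.norm.continuousOn hpos
  obtain ⟨T, hT⟩ := eventually_atTop.1 (h.eventually (gt_mem_nhds hδ))
  refine ⟨max T 0, fun t ht => ?_⟩
  by_contra hcon
  refine absurd (hδK (u t) ⟨?_, ?_⟩) (not_le.2 (hT t (le_of_max_le_left ht)))
  · simpa using hR t (le_of_max_le_right ht)
  · rw [Metric.mem_thickening_iff]
    exact hcon

/-! ### The Lyapunov function of the Chua system -/

theorem IsChuaSolution.hasDerivWithinAt_coord {α β m₀ m₁ γ x₀ : ℝ} {u : ℝ → Phase}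
    (hu : IsChuaSolution α β m₀ m₁ γ x₀ u) {t : ℝ} (ht : 0 ≤ t) (i : Fin 3) :
    HasDerivWithinAt (fun s => u s i) (chuaField α β m₀ m₁ γ x₀ (u t) i) (Ici 0) t :=
  (EuclideanSpace.proj i : Phase →L[ℝ] ℝ).hasFDerivAt.comp_hasDerivWithinAt t (hu t ht)

/-- The Lyapunov function `τ / 2 * f₁² + G`, where `∇ G = P f` with
`P = !![κ, p, r; 0, κ α - p + r β, c; 0, p - r γ, e]`. The polynomial `G` is `½ uᵀ P A u` plus
the contributions of the cubic and constant terms of `f`, `A` being the linear part of `f`; it has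
the stated gradient when `c γ + e β = κ α + r (β - γ)`, which makes `P A` symmetric. -/
noncomputable def chuaLyapunov (α β m₀ m₁ γ x₀ τ κ p r c e : ℝ) (v : Phase) : ℝ :=
  τ / 2 * chuaField α β m₀ m₁ γ x₀ v 0 ^ 2
    + (κ * (α * (m₀ - 1)) + p) / 2 * v 0 ^ 2 + (κ * α - p + r * β) * (v 0 * v 1)
    + (p - r * γ) * (v 0 * v 2) + (c * β - (κ * α - p + r * β)) / 2 * v 1 ^ 2
    + (κ * α - p + r * β - c * γ) * (v 1 * v 2) + (p - r * γ - e * γ) / 2 * v 2 ^ 2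
    - κ * (α * m₁) / 4 * v 0 ^ 4
    + κ * (α * x₀) * v 0

theorem hasDerivWithinAt_chuaLyapunov {α β m₀ m₁ γ x₀ τ κ p r c e : ℝ}
    (hce : c * γ + e * β = κ * α + r * (β - γ)) {u : ℝ → Phase}
    (hu : IsChuaSolution α β m₀ m₁ γ x₀ u) {t : ℝ} (ht : 0 ≤ t) :
    HasDerivWithinAt (fun s => chuaLyapunov α β m₀ m₁ γ x₀ τ κ p r c e (u s))
      (let f := chuaField α β m₀ m₁ γ x₀ (u t)
       τ * f 0 * (α * (m₀ - 1) * f 0 + α * f 1) + κ * f 0 ^ 2 + p * f 0 * f 1 + r * f 0 * f 2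
          + (κ * α - p + r * β) * f 1 ^ 2 + (c + p - r * γ) * f 1 * f 2 + e * f 2 ^ 2
          - 3 * τ * (α * m₁) * (u t 0 * f 0) ^ 2) (Ici 0) t := by
  have h0 := hu.hasDerivWithinAt_coord ht 0
  have h1 := hu.hasDerivWithinAt_coord ht 1
  have h2 := hu.hasDerivWithinAt_coord ht 2
  have hf := (((h0.const_mul (α * (m₀ - 1))).add (h1.const_mul α)).sub
    ((h0.pow 3).const_mul (α * m₁))).add_const (α * x₀)
  have := ((((((((hf.pow 2).const_mul (τ / 2)).add
    ((h0.pow 2).const_mul ((κ * (α * (m₀ - 1)) + p) / 2))).add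
    ((h0.mul h1).const_mul (κ * α - p + r * β))).add
    ((h0.mul h2).const_mul (p - r * γ))).add
    ((h1.pow 2).const_mul ((c * β - (κ * α - p + r * β)) / 2))).add
    ((h1.mul h2).const_mul (κ * α - p + r * β - c * γ))).add
    ((h2.pow 2).const_mul ((p - r * γ - e * γ) / 2))).sub
    ((h0.pow 4).const_mul (κ * (α * m₁) / 4)) |>.add
    (h0.const_mul (κ * (α * x₀)))
  refine HasDerivWithinAt.congr_deriv this ?_
  simp only [chuaField, Matrix.cons_val_zero, Matrix.cons_val_one, Matrix.cons_val,
    Pi.add_apply, Pi.sub_apply, Pi.pow_apply]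
  push_cast
  linear_combination -(u t 1 * (β * u t 1 - γ * u t 2)) * hce

theorem contDiff_chuaField (α β m₀ m₁ γ x₀ : ℝ) : ContDiff ℝ 1 (chuaField α β m₀ m₁ γ x₀) := by
  rw [contDiff_euclidean]
  have h : ∀ i : Fin 3, ContDiff ℝ 1 (fun v : Phase => v i) := fun i =>
    (EuclideanSpace.proj i : Phase →L[ℝ] ℝ).contDiff
  intro i
  fin_cases i <;> simp [chuaField] <;> fun_prop

/-- Along a bounded solution of `u' = f(u)` with `f` of class `C¹`, `‖f‖²` is Lipschitz in time. -/
theorem exists_lipschitz_normSq_comp {f : Phase → Phase} (hf : ContDiff ℝ 1 f) {u : ℝ → Phase}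
    (hu : ∀ t, 0 ≤ t → HasDerivWithinAt u (f (u t)) (Ici 0) t) {R : ℝ}
    (hR : ∀ t, 0 ≤ t → ‖u t‖ ≤ R) :
    ∃ K, 0 ≤ K ∧ ∀ s t, 0 ≤ s → 0 ≤ t → |‖f (u s)‖ ^ 2 - ‖f (u t)‖ ^ 2| ≤ K * |s - t| := by
  have hmem : ∀ t, 0 ≤ t → u t ∈ Metric.closedBall (0 : Phase) R := fun t ht => by
    simpa using hR t ht
  obtain ⟨M, hM⟩ := (isCompact_closedBall (0 : Phase) R).exists_bound_of_continuousOn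
    hf.continuous.continuousOn
  obtain ⟨C, hC⟩ := (isCompact_closedBall (0 : Phase) R).exists_bound_of_continuousOn
    ((hf.continuous_fderiv one_ne_zero).clm_apply hf.continuous).continuousOn
  have hM0 : 0 ≤ M := (norm_nonneg _).trans (hM _ (hmem 0 le_rfl))
  have hC0 : 0 ≤ C := (norm_nonneg _).trans (hC _ (hmem 0 le_rfl))
  refine ⟨C * (2 * M), by positivity, fun s t hs ht => ?_⟩
  have hlip : ‖f (u s) - f (u t)‖ ≤ C * ‖s - t‖ :=
    (convex_Ici (0 : ℝ)).norm_image_sub_le_of_norm_hasDerivWithin_le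
      (fun x hx => ((hf.differentiable one_ne_zero).differentiableAt.hasFDerivAt
        (x := u x)).comp_hasDerivWithinAt x (hu x hx)) (fun x hx => hC _ (hmem x hx)) ht hs
  have hs' := hM _ (hmem s hs)
  have ht' := hM _ (hmem t ht)
  rw [sq_sub_sq, abs_mul, abs_of_nonneg (by positivity), ← Real.norm_eq_abs (s - t)]
  calc (‖f (u s)‖ + ‖f (u t)‖) * |‖f (u s)‖ - ‖f (u t)‖|
      ≤ (2 * M) * (C * ‖s - t‖) :=
        mul_le_mul (by linarith) ((abs_norm_sub_norm_le _ _).trans hlip) (abs_nonneg _)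
          (by linarith)
    _ = C * (2 * M) * ‖s - t‖ := by ring

end

theorem mainTheorem2 (α β m₀ m₁ γ x₀ : ℝ) (hαm₁ : 0 < α * m₁)
    (hlam : chuaEigenvalue α β m₀ m₁ γ 0 0 + chuaEigenvalue α β m₀ m₁ γ 0 1 < 0)
    (u : ℝ → Phase) (hu : IsChuaSolution α β m₀ m₁ γ x₀ u)
    (hbdd : Bornology.IsBounded (u '' Set.Ici 0)) :
    TendsToSet u (chuaStationarySet α β m₀ m₁ γ x₀) := by
  obtain ⟨R, hR⟩ := hbdd.exists_norm_le
  replace hR : ∀ t, 0 ≤ t → ‖u t‖ ≤ R := fun t ht => hR _ ⟨t, ht, rfl⟩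
  obtain ⟨h1, h2, h3, h12, h23⟩ := parameter_bounds_of_eigenvalue_sum_neg hlam
  obtain ⟨τ, κ, p, r, c, e, ε, hτ, hε, hce, hform⟩ :=
    exists_multiplier (left_ne_zero_of_mul hαm₁.ne') h1 h2 h3 h12 h23
  have hf := contDiff_chuaField α β m₀ m₁ γ x₀
  obtain ⟨K, hK0, hK⟩ := exists_lipschitz_normSq_comp hf hu hR
  have hVcont : Continuous (chuaLyapunov α β m₀ m₁ γ x₀ τ κ p r c e) := by
    have hc : ∀ i : Fin 3, Continuous fun v : Phase => v i := fun i =>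
      (EuclideanSpace.proj i : Phase →L[ℝ] ℝ).continuous
    have := (hc 0).comp hf.continuous
    unfold chuaLyapunov
    fun_prop
  obtain ⟨B, hB⟩ := (isCompact_closedBall (0 : Phase) R).exists_bound_of_continuousOn
    hVcont.continuousOn
  refine tendsToSet_of_tendsto_zero hf.continuous hR ?_
  -- the term with `α m₁` in the derivative of `V` has the favourable sign and is dropped
  have key := tendsto_zero_of_hasDerivWithinAt_le_neg (m := -B) (K := ε * K)
    (g := fun t => ε * ‖chuaField α β m₀ m₁ γ x₀ (u t)‖ ^ 2)
    (fun t ht => hasDerivWithinAt_chuaLyapunov (τ := τ) hce hu ht) (fun t ht => ?_)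
    (fun t ht => (abs_le.1 (hB (u t) (by simpa using hR t ht))).1) (fun t _ => by positivity)
    (by positivity) fun s t hs ht => ?_
  · have h := (key.const_mul ε⁻¹).sqrt
    simpa [hε.ne'] using h
  · have := hform (chuaField α β m₀ m₁ γ x₀ (u t) 0) (chuaField α β m₀ m₁ γ x₀ (u t) 1)
      (chuaField α β m₀ m₁ γ x₀ (u t) 2)
    have hcub : 0 ≤ 3 * τ * (α * m₁) * (u t 0 * chuaField α β m₀ m₁ γ x₀ (u t) 0) ^ 2 := by
      positivity
    simp only [EuclideanSpace.real_norm_sq_eq, Fin.sum_univ_three]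
    linarith
  · rw [← mul_sub, abs_mul, abs_of_pos hε, mul_assoc]
    exact mul_le_mul_of_nonneg_left (hK s t hs ht) hε.le
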